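/- Fix a prime $p$ and an integer $n\ge 1$. All rings are graded (cohomologically), and power series and Laurent series rings are formed in the graded sense: they are the direct sums over $d\in\mathbb Z$ of the groups of series that are homogeneous of degree $d$. Let $$E_n^*=\mathbb Z_p[u^{\pm1}][[v_1,\dots,v_{n-1}]],\qquad |u|=-2,\quad |v_i|=-2(p^i-1),$$ and put $v_0=p$, $v_n=u^{p^n-1}$ and $v_i=0$ for $i>n$. Let $F$ be a commutative one-dimensional formal group law over $E_n^*$, homogeneous of degree $2$ in variables of degree $2$, whose $p$-series is $$[p](y)=py+_Fv_1y^p+_F\cdots+_Fv_{n-1}y^{p^{n-1}}+_Fu^{p^n-1}y^{p^n}.$$ Let $|y|=2$, and let $E_n^*(BC_p)=E_n^*[[y]]/([p](y))$; by a standard computation this is the Morava $E$-cohomology of the classifying space of the cyclic group $C_p$, with $y$ the Euler class $e$ of the standard representation $C_p\hookrightarrow U(1)$. A commutative ring $R$ on which elements $v_0=p,v_1,v_2,\dots$ act is called Landweber exact if $v_k$ is a nonzerodivisor on $R/(v_0,\dots,v_{k-1})$ for every $k\ge0$, and $v_m$-periodic if $R/(v_0,\dots,v_{m-1})$ is nonzero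 and $v_m$ is a unit in it. **Proposition 3.2.** There is a ring isomorphism $y^{-1}E_n^*(BC_p)\cong E_n^*((y))/([p](y))$ compatible with the canonical maps from $E_n^*[[y]]$, and the ring $y^{-1}E_n^*(BC_p)$ is Landweber exact and $v_{n-1}$-periodic. -/

import Mathlib

noncomputable section

namespace MoravaE

/-! ### Graded rings given by homogeneous pieces

All rings are graded cohomologically, as direct sums of their homogeneous pieces; in particular a
power series or Laurent series ring over a graded ring is formed in the graded sense, its piece of
degree `d` consisting of all the series that are homogeneous of degree `d`. -/

/-- The subring of finite sums of homogeneous elements, for a multiplicative family of pieces. -/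
def homogSubring {S : Type*} [CommRing S] (B : ℤ → AddSubgroup S) [SetLike.GradedMonoid B] :
    Subring S where
  carrier := (⨆ d, B d : AddSubgroup S)
  zero_mem' := zero_mem _
  add_mem' := add_mem
  neg_mem' := neg_mem
  one_mem' := (le_iSup B 0) SetLike.GradedOne.one_mem
  mul_mem' := by
    intro a b ha hb
    refine AddSubgroup.iSup_induction B (C := fun x => x * b ∈ (⨆ d, B d : AddSubgroup S))
      ha (fun i x hx => ?_) (by simp) (fun x y hx hy => by rw [add_mul]; exact add_mem hx hy)
    refine AddSubgroup.iSup_induction B (C := fun z => x * z ∈ (⨆ d, B d : AddSubgroup S))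
      hb (fun j z hz => ?_) (by simp) (fun y z hy hz => by rw [mul_add]; exact add_mem hy hz)
    exact (le_iSup B (i + j)) (SetLike.GradedMul.mul_mem hx hz)

lemma mem_homogSubring {S : Type*} [CommRing S] (B : ℤ → AddSubgroup S)
    [SetLike.GradedMonoid B] {x : S} {d : ℤ} (hx : x ∈ B d) : x ∈ homogSubring B :=
  (le_iSup B d) hx

lemma map_mem_homogSubring {S T : Type*} [CommRing S] [CommRing T] (B : ℤ → AddSubgroup S)
    (B' : ℤ → AddSubgroup T) [SetLike.GradedMonoid B] [SetLike.GradedMonoid B'] (f : S →+* T)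
    (hf : ∀ d, ∀ x ∈ B d, f x ∈ B' d) {x : S} (hx : x ∈ homogSubring B) :
    f x ∈ homogSubring B' :=
  AddSubgroup.iSup_induction B (C := fun x => f x ∈ homogSubring B') hx
    (fun d x hx => mem_homogSubring B' (hf d x hx)) (by simp)
    (fun x y hx hy => by rw [map_add]; exact add_mem hx hy)

/-- The homogeneous pieces of `homogSubring B`, as subgroups of it. -/
def pieces {S : Type*} [CommRing S] (B : ℤ → AddSubgroup S) [SetLike.GradedMonoid B] (d : ℤ) :
    AddSubgroup (homogSubring B) :=
  (B d).comap (homogSubring B).subtype.toAddMonoidHom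

lemma mem_iSup_pieces {S : Type*} [CommRing S] (B : ℤ → AddSubgroup S) [SetLike.GradedMonoid B]
    (x : homogSubring B) : x ∈ ⨆ d, pieces B d := by
  obtain ⟨x, hx⟩ := x
  obtain ⟨h, hh⟩ := AddSubgroup.iSup_induction B
    (C := fun x => ∃ h : x ∈ homogSubring B, (⟨x, h⟩ : homogSubring B) ∈ ⨆ d, pieces B d) hx
    (fun d x hx => ⟨mem_homogSubring B hx, (le_iSup (pieces B) d) hx⟩)
    ⟨zero_mem _, zero_mem _⟩
    (fun x y ⟨h, hh⟩ ⟨h', hh'⟩ => ⟨add_mem h h', add_mem hh hh'⟩)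
  exact hh

instance {S : Type*} [CommRing S] (B : ℤ → AddSubgroup S) [SetLike.GradedMonoid B] :
    SetLike.GradedMonoid (pieces B) where
  one_mem := SetLike.GradedOne.one_mem (A := B)
  mul_mem _ _ _ _ hx hy := SetLike.GradedMul.mul_mem (A := B) hx hy

/-- Power series in variables of degrees `w` over a graded ring that are homogeneous of degree
`d`: the coefficient of the monomial `m` is homogeneous of degree `d - |m|`. -/
def homogSeries {R : Type*} [CommRing R] (A : ℤ → AddSubgroup R) {σ : Type*} (w : σ → ℤ) (d : ℤ) :
    AddSubgroup (MvPowerSeries σ R) where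
  carrier := {f | ∀ m : σ →₀ ℕ, MvPowerSeries.coeff m f ∈ A (d - Finsupp.weight w m)}
  zero_mem' m := by simp
  add_mem' hf hg m := by rw [map_add]; exact add_mem (hf m) (hg m)
  neg_mem' hf m := by rw [map_neg]; exact neg_mem (hf m)

instance {R : Type*} [CommRing R] (A : ℤ → AddSubgroup R) [SetLike.GradedMonoid A] {σ : Type*}
    (w : σ → ℤ) : SetLike.GradedMonoid (homogSeries A w) where
  one_mem m := by
    classical
    rw [MvPowerSeries.coeff_one]
    split_ifs with h
    · subst h
      simpa using SetLike.GradedOne.one_mem (A := A)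
    · exact zero_mem _
  mul_mem i j f g hf hg m := by
    classical
    rw [MvPowerSeries.coeff_mul]
    refine sum_mem fun x hx => ?_
    have h := SetLike.GradedMul.mul_mem (hf x.1) (hg x.2)
    rw [Finset.HasAntidiagonal.mem_antidiagonal] at hx
    have e : i - Finsupp.weight w x.1 + (j - Finsupp.weight w x.2)
        = i + j - Finsupp.weight w m := by
      rw [← hx, map_add]; ring
    rwa [e] at h

/-- Laurent series in one variable of degree `w` over a graded ring that are homogeneous of
degree `d`. -/
def homogLaurent {R : Type*} [CommRing R] (A : ℤ → AddSubgroup R) (w d : ℤ) :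
    AddSubgroup (LaurentSeries R) where
  carrier := {f | ∀ k : ℤ, f.coeff k ∈ A (d - k * w)}
  zero_mem' k := by simp
  add_mem' hf hg k := by rw [HahnSeries.coeff_add]; exact add_mem (hf k) (hg k)
  neg_mem' hf k := by rw [HahnSeries.coeff_neg]; exact neg_mem (hf k)

instance {R : Type*} [CommRing R] (A : ℤ → AddSubgroup R) [SetLike.GradedMonoid A] (w : ℤ) :
    SetLike.GradedMonoid (homogLaurent A w) where
  one_mem k := by
    rw [HahnSeries.coeff_one]
    split_ifs with h
    · subst h
      simpa using SetLike.GradedOne.one_mem (A := A)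
    · exact zero_mem _
  mul_mem i j f g hf hg k := by
    rw [HahnSeries.coeff_mul]
    refine sum_mem fun x hx => ?_
    have h := SetLike.GradedMul.mul_mem (hf x.1) (hg x.2)
    rw [Finset.mem_antidiagonal] at hx
    have e : i - x.1 * w + (j - x.2 * w) = i + j - k * w := by
      rw [← hx.2.2]; ring
    rwa [e] at h

lemma ofPowerSeries_mem_homogLaurent {R : Type*} [CommRing R] (A : ℤ → AddSubgroup R) (w : ℤ)
    {d : ℤ} {f : PowerSeries R} (hf : f ∈ homogSeries A (fun _ : Unit => w) d) :
    HahnSeries.ofPowerSeries ℤ R f ∈ homogLaurent A w d := by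
  intro k
  by_cases hk : 0 ≤ k
  · obtain ⟨m, rfl⟩ := Int.eq_ofNat_of_zero_le hk
    rw [HahnSeries.ofPowerSeries_apply_coeff]
    simpa [Finsupp.weight_apply] using hf (Finsupp.single () m)
  · rw [HahnSeries.ofPowerSeries_apply, HahnSeries.embDomain_of_notMem_range]
    · exact zero_mem _
    · rintro ⟨m, hm⟩
      simp at hm
      omega

/-- Substituting homogeneous series of the right degrees into a homogeneous series gives a
homogeneous series. -/
lemma subst_mem_homogSeries {R : Type*} [CommRing R] (A : ℤ → AddSubgroup R)
    [SetLike.GradedMonoid A] {σ τ : Type*} {w : σ → ℤ} {w' : τ → ℤ} {d : ℤ}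
    {f : MvPowerSeries σ R} (hf : f ∈ homogSeries A w d) {a : σ → MvPowerSeries τ R}
    (hs : MvPowerSeries.HasSubst a) (ha : ∀ s, a s ∈ homogSeries A w' (w s)) :
    MvPowerSeries.subst a f ∈ homogSeries A w' d := by
  intro e
  rw [MvPowerSeries.coeff_subst hs]
  refine finsum_induction (fun x => x ∈ A (d - Finsupp.weight w' e)) (zero_mem _)
    (fun _ _ => add_mem) (fun m => ?_)
  have hprod : (m.prod fun s k => a s ^ k) ∈ homogSeries A w' (Finsupp.weight w m) := by
    rw [Finsupp.weight_apply]
    exact SetLike.prod_mem_graded (A := homogSeries A w') (fun s => m s • w s) _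
      (fun s _ => SetLike.pow_mem_graded (m s) (ha s))
  have h := SetLike.GradedMul.mul_mem (hf m) (hprod e)
  rw [smul_eq_mul]
  have e' : d - Finsupp.weight w m + (Finsupp.weight w m - Finsupp.weight w' e)
      = d - Finsupp.weight w' e := by ring
  rwa [e'] at h

/-! ### The coefficient ring of Morava `E`-theory -/

/-- The piece of degree `d` of `ℤ_p[u^{±1}]`, where `u` has degree `-2`. -/
def laurentPiece (p : ℕ) [Fact p.Prime] (d : ℤ) : AddSubgroup (LaurentPolynomial ℤ_[p]) where
  carrier := {f | ∀ k : ℤ, f.coeff k ≠ 0 → -2 * k = d}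
  zero_mem' k h := by simp at h
  add_mem' {f g} hf hg k h := by
    by_cases h1 : f.coeff k = 0
    · by_cases h2 : g.coeff k = 0
      · exact absurd (by simp [h1, h2]) h
      · exact hg k h2
    · exact hf k h1
  neg_mem' {f} hf k h := hf k (by simpa using h)

instance (p : ℕ) [Fact p.Prime] : SetLike.GradedMonoid (laurentPiece p) where
  one_mem k h := by
    by_cases hk : k = 0
    · simp [hk]
    · rw [← LaurentPolynomial.T_zero, LaurentPolynomial.T_apply, if_neg (Ne.symm hk)] at h
      exact absurd rfl h
  mul_mem i j f g hf hg k h := by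
    classical
    rw [AddMonoidAlgebra.coeff_mul, Finsupp.sum] at h
    obtain ⟨a, ha, h⟩ := Finset.exists_ne_zero_of_sum_ne_zero h
    rw [Finsupp.sum] at h
    obtain ⟨b, hb, h⟩ := Finset.exists_ne_zero_of_sum_ne_zero h
    have h1 := hf a (Finsupp.mem_support_iff.mp ha)
    have h2 := hg b (Finsupp.mem_support_iff.mp hb)
    have h3 : a + b = k := by
      by_contra hne
      exact h (if_neg hne)
    rw [← h1, ← h2, ← h3]; ring

/-- The degree of the generator `v_{i+1}`, namely `-2 (p^{i+1} - 1)`. -/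
def vDeg (p n : ℕ) (i : Fin (n - 1)) : ℤ := -2 * ((p : ℤ) ^ (i.val + 1) - 1)

/-- The coefficient ring `E_n^* = ℤ_p[u^{±1}][[v_1, …, v_{n-1}]]` (graded power series);
the variable with index `i : Fin (n - 1)` is `v_{i+1}`. -/
abbrev Coeff (p n : ℕ) [Fact p.Prime] : Type :=
  homogSubring (homogSeries (laurentPiece p) (vDeg p n))

/-- The homogeneous pieces `E_n^d` of `E_n^*`. -/
abbrev coeffPiece (p n : ℕ) [Fact p.Prime] (d : ℤ) : AddSubgroup (Coeff p n) :=
  pieces (homogSeries (laurentPiece p) (vDeg p n)) d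

lemma T_mem (p : ℕ) [Fact p.Prime] (k : ℤ) :
    (LaurentPolynomial.T k : LaurentPolynomial ℤ_[p]) ∈ laurentPiece p (-2 * k) := by
  intro j hj
  rw [LaurentPolynomial.T_apply] at hj
  by_cases h : k = j
  · rw [h]
  · rw [if_neg h] at hj
    exact absurd rfl hj

lemma C_mem_homogSeries {R : Type*} [CommRing R] (A : ℤ → AddSubgroup R) {σ : Type*}
    (w : σ → ℤ) {d : ℤ} {a : R} (ha : a ∈ A d) : MvPowerSeries.C a ∈ homogSeries A w d := by
  classical
  intro m
  rw [MvPowerSeries.coeff_C]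
  split_ifs with h
  · subst h
    simpa using ha
  · exact zero_mem _

lemma X_mem_homogSeries {R : Type*} [CommRing R] (A : ℤ → AddSubgroup R) [SetLike.GradedMonoid A]
    {σ : Type*} (w : σ → ℤ) (s : σ) : MvPowerSeries.X s ∈ homogSeries A w (w s) := by
  classical
  intro m
  rw [MvPowerSeries.coeff_X]
  split_ifs with h
  · subst h
    simpa [Finsupp.weight_apply] using SetLike.GradedOne.one_mem (A := A)
  · exact zero_mem _

/-- The element `u` of `E_n^*`, of degree `-2`. -/
def u (p n : ℕ) [Fact p.Prime] : Coeff p n :=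
  ⟨MvPowerSeries.C (LaurentPolynomial.T 1),
    mem_homogSubring _ (C_mem_homogSeries _ _ (T_mem p 1))⟩

/-- The images in `E_n^*` of the generators of `BP_* = ℤ_(p)[v_1, v_2, …]`, with `v_0 = p`:
`v_1, …, v_{n-1}` are the power series variables, `v_n = u^{p^n - 1}`, and `v_i = 0` for
`i > n`. -/
def v (p n : ℕ) [Fact p.Prime] (i : ℕ) : Coeff p n :=
  if i = 0 then (p : Coeff p n)
  else if h : i - 1 < n - 1 then
    ⟨MvPowerSeries.X ⟨i - 1, h⟩, mem_homogSubring _ (X_mem_homogSeries _ _ _)⟩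
  else if i = n then u p n ^ (p ^ n - 1)
  else 0

/-! ### The formal group law and its `p`-series -/

/-- The series `a y^k` with `k ≥ 1`, as a point of a formal group law. -/
def monomialPoint {R : Type*} [CommRing R] (F : FormalGroup R) (a : R) (k : ℕ) (hk : k ≠ 0) :
    F.Point Unit :=
  ⟨(PowerSeries.C a * PowerSeries.X ^ k : PowerSeries R),
    PowerSeries.HasSubst.of_constantCoeff_zero' (by simp [hk])⟩

/-- The `m`-series `[m](y) = y +_F ⋯ +_F y` (`m` terms). -/
def mSeries {R : Type*} [CommRing R] (F : FormalGroup R) (m : ℕ) : PowerSeries R :=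
  (m • monomialPoint F 1 1 one_ne_zero : F.Point Unit).val

/-- `F` is a formal group law of Morava `E`-theory: a commutative formal group law over `E_n^*`
which is homogeneous (`F(y, y')` has degree `2` when `y` and `y'` have degree `2`) and satisfies
`[p](y) = p y +_F v_1 y^p +_F ⋯ +_F v_{n-1} y^{p^{n-1}} +_F u^{p^n - 1} y^{p^n}`. -/
structure IsMoravaFormalGroup (p n : ℕ) [hp : Fact p.Prime] (F : FormalGroup (Coeff p n)) :
    Prop where
  comm : F.IsComm
  homogeneous : F.toPowerSeries ∈ homogSeries (coeffPiece p n) (fun _ : Fin 2 => 2) 2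
  pSeries_eq : mSeries F p = (((List.range (n + 1)).map fun i =>
    monomialPoint F (v p n i) (p ^ i) (pow_ne_zero i hp.out.ne_zero)).sum : F.Point Unit).val

/-! ### The rings `E_n^*[[y]]`, `E_n^*((y))` and `E_n^*(BC_p)` -/

/-- `E_n^*[[y]]` (graded power series), with `y` of degree `2`. -/
abbrev SeriesRing (p n : ℕ) [Fact p.Prime] : Type :=
  homogSubring (homogSeries (coeffPiece p n) (fun _ : Unit => 2))

/-- `E_n^*((y))` (graded Laurent series), with `y` of degree `2`. -/
abbrev LaurentRing (p n : ℕ) [Fact p.Prime] : Type :=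
  homogSubring (homogLaurent (coeffPiece p n) 2)

/-- The element `y` of `E_n^*[[y]]`. -/
def y (p n : ℕ) [Fact p.Prime] : SeriesRing p n :=
  ⟨(PowerSeries.X : PowerSeries (Coeff p n)), mem_homogSubring _ (X_mem_homogSeries _ _ ())⟩

/-- The inclusion of coefficients `E_n^* → E_n^*[[y]]`. -/
def coeffMap (p n : ℕ) [Fact p.Prime] : Coeff p n →+* SeriesRing p n :=
  RingHom.codRestrict (MvPowerSeries.C (σ := Unit) (R := Coeff p n))
    (homogSubring (homogSeries (coeffPiece p n) (fun _ : Unit => 2))) (fun x => by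
      refine AddSubgroup.iSup_induction (coeffPiece p n) (C := fun x => MvPowerSeries.C x ∈
        homogSubring (homogSeries (coeffPiece p n) (fun _ : Unit => 2))) (mem_iSup_pieces _ x)
        (fun d x hx => mem_homogSubring _ (C_mem_homogSeries _ _ hx)) (by simp)
        (fun x y hx hy => by rw [map_add]; exact add_mem hx hy))

/-- The inclusion `E_n^*[[y]] → E_n^*((y))`. -/
def seriesToLaurent (p n : ℕ) [Fact p.Prime] : SeriesRing p n →+* LaurentRing p n :=
  RingHom.codRestrict ((HahnSeries.ofPowerSeries ℤ (Coeff p n)).comp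
      (homogSubring (homogSeries (coeffPiece p n) (fun _ : Unit => 2))).subtype)
    (homogSubring (homogLaurent (coeffPiece p n) 2))
    (fun x => map_mem_homogSubring (homogSeries (coeffPiece p n) (fun _ : Unit => 2))
      (homogLaurent (coeffPiece p n) 2) (HahnSeries.ofPowerSeries ℤ (Coeff p n))
      (fun _ _ => ofPowerSeries_mem_homogLaurent _ 2) x.2)

lemma mSeries_mem {p n : ℕ} [Fact p.Prime] {F : FormalGroup (Coeff p n)}
    (hF : IsMoravaFormalGroup p n F) (m : ℕ) :
    mSeries F m ∈ homogSeries (coeffPiece p n) (fun _ : Unit => 2) 2 := by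
  unfold mSeries
  induction m with
  | zero =>
    rw [zero_nsmul]
    exact zero_mem _
  | succ k ih =>
    rw [succ_nsmul, FormalGroup.add_apply]
    refine subst_mem_homogSeries _ hF.homogeneous
      (MvPowerSeries.hasSubst_of_constantCoeff_nilpotent fun s => ?_) fun s => ?_
    · fin_cases s
      · exact (k • monomialPoint F 1 1 one_ne_zero : F.Point Unit).2
      · exact (monomialPoint F 1 1 one_ne_zero : F.Point Unit).2
    · fin_cases s
      · exact ih
      · have h := X_mem_homogSeries (coeffPiece p n) (fun _ : Unit => (2 : ℤ)) ()
        simpa [monomialPoint, PowerSeries.X] using h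

/-- The `p`-series `[p](y)` as an element of `E_n^*[[y]]`. -/
def pSeries {p n : ℕ} [Fact p.Prime] {F : FormalGroup (Coeff p n)}
    (hF : IsMoravaFormalGroup p n F) : SeriesRing p n :=
  ⟨mSeries F p, mem_homogSubring _ (mSeries_mem hF p)⟩

/-- `E_n^*(BC_p) = E_n^*[[y]]/([p](y))`. -/
def CohomologyBCp {p n : ℕ} [Fact p.Prime] {F : FormalGroup (Coeff p n)}
    (hF : IsMoravaFormalGroup p n F) : Type :=
  SeriesRing p n ⧸ Ideal.span {pSeries hF}

instance {p n : ℕ} [Fact p.Prime] {F : FormalGroup (Coeff p n)}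
    (hF : IsMoravaFormalGroup p n F) : CommRing (CohomologyBCp hF) :=
  inferInstanceAs (CommRing (SeriesRing p n ⧸ Ideal.span {pSeries hF}))

/-- The quotient map `E_n^*[[y]] → E_n^*(BC_p)`. -/
def toCohomology {p n : ℕ} [Fact p.Prime] {F : FormalGroup (Coeff p n)}
    (hF : IsMoravaFormalGroup p n F) : SeriesRing p n →+* CohomologyBCp hF :=
  Ideal.Quotient.mk (Ideal.span {pSeries hF})

/-- The Euler class `e = y` in `E_n^*(BC_p)`. -/
def eulerClass {p n : ℕ} [Fact p.Prime] {F : FormalGroup (Coeff p n)}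
    (hF : IsMoravaFormalGroup p n F) : CohomologyBCp hF :=
  toCohomology hF (y p n)

/-- `E_n^*((y))/([p](y))`. -/
def LaurentQuotient {p n : ℕ} [Fact p.Prime] {F : FormalGroup (Coeff p n)}
    (hF : IsMoravaFormalGroup p n F) : Type :=
  LaurentRing p n ⧸ Ideal.span {seriesToLaurent p n (pSeries hF)}

instance {p n : ℕ} [Fact p.Prime] {F : FormalGroup (Coeff p n)}
    (hF : IsMoravaFormalGroup p n F) : CommRing (LaurentQuotient hF) :=
  inferInstanceAs (CommRing (LaurentRing p n ⧸ Ideal.span {seriesToLaurent p n (pSeries hF)}))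

/-- The ring `e^{-1} E_n^*(BC_p)`. -/
abbrev LocalizedCohomology {p n : ℕ} [Fact p.Prime] {F : FormalGroup (Coeff p n)}
    (hF : IsMoravaFormalGroup p n F) : Type :=
  Localization.Away (eulerClass hF)

/-- The canonical map `E_n^*[[y]] → e^{-1} E_n^*(BC_p)`. -/
def toLocalized {p n : ℕ} [Fact p.Prime] {F : FormalGroup (Coeff p n)}
    (hF : IsMoravaFormalGroup p n F) : SeriesRing p n →+* LocalizedCohomology hF :=
  (algebraMap (CohomologyBCp hF) (LocalizedCohomology hF)).comp (toCohomology hF)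

/-- The canonical map `E_n^*[[y]] → E_n^*((y))/([p](y))`. -/
def toLaurentQuotient {p n : ℕ} [Fact p.Prime] {F : FormalGroup (Coeff p n)}
    (hF : IsMoravaFormalGroup p n F) : SeriesRing p n →+* LaurentQuotient hF :=
  (Ideal.Quotient.mk (Ideal.span {seriesToLaurent p n (pSeries hF)})).comp (seriesToLaurent p n)

/-- The images of `v_0 = p, v_1, v_2, …` in `e^{-1} E_n^*(BC_p)`. -/
def vLocalized {p n : ℕ} [Fact p.Prime] {F : FormalGroup (Coeff p n)}
    (hF : IsMoravaFormalGroup p n F) (i : ℕ) : LocalizedCohomology hF :=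
  toLocalized hF (coeffMap p n (v p n i))

/-! ### Landweber exactness and periodicity -/

/-- A ring on which the generators `v_0 = p, v_1, v_2, …` act through `w` is Landweber exact if
they act as a regular sequence: each `v_k` is a nonzerodivisor modulo `(v_0, …, v_{k-1})`. -/
def IsLandweberExact {R : Type*} [CommRing R] (w : ℕ → R) : Prop :=
  ∀ k, RingTheory.Sequence.IsWeaklyRegular R ((List.range k).map w)

/-- A ring on which the generators `v_0 = p, v_1, v_2, …` act through `w` is `v_m`-periodic if
its quotient by `(v_0, …, v_{m-1})` is nonzero and `v_m` is a unit in this quotient. -/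
def IsPeriodic {R : Type*} [CommRing R] (w : ℕ → R) (m : ℕ) : Prop :=
  Nontrivial (R ⧸ Ideal.ofList ((List.range m).map w)) ∧
    IsUnit (Ideal.Quotient.mk (Ideal.ofList ((List.range m).map w)) (w m))

end MoravaE

end

noncomputable section

namespace MoravaE

section Projections

/-! ### Projections to homogeneous pieces -/

/-! Write I_k = (v_0, …, v_{k-1}). Everything rests on the congruence [p](y) ≡ v_k y^{p^k} + (higher
order) mod I_k for k ≤ n: the formal summands with i < k vanish mod I_k, and those with i > k start
beyond degree p^k (`pSeries_sub_mem`). Since v_0, …, v_{n-1} is regular on E_n^*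
(`mem_vIdeal_of_v_mul_mem`), comparing lowest coefficients shows that [p](y) is a nonzerodivisor on
E_n^*[[y]]/I_k for k < n.

For k < n - 1 an exchange argument then makes v_k regular on E_n^*(BC_p)/I_k
(`mem_sup_of_v_mul_mem`), and localization preserves this. For k = n the leading coefficient v_n is
a unit, so y^{p^n} is killed in E_n^*(BC_p)/I_n (`y_pow_mem`). Inverting y therefore makes the
quotient by I_n zero, that is, v_{n-1} becomes a unit mod I_{n-1}; beyond that index regularity is
vacuous. The quotient by I_{n-1} survives because no power of y is a multiple of [p](y) there
(`y_pow_notMem`).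

The isomorphism holds because a graded Laurent series is a power of y away from a power series, and
localization commutes with quotients.

Gradedness costs some care: the series rings contain only finite sums of homogeneous series, so
multipliers chosen coefficient by coefficient need not assemble into an element of the ring.
Projecting them to the degrees forced by homogeneity repairs this (`mem_span_of_coeff_mem`). The
homogeneous pieces do not span the full power series ring, so these projections are not required to
come from a direct sum decomposition. -/

/-- Additive projections of a ring to the members of a family of subgroups. -/
structure Projections {R : Type*} [CommRing R] (A : ℤ → AddSubgroup R) where
  proj : ℤ → R →+ R
  proj_mem : ∀ d x, proj d x ∈ A d
  proj_self : ∀ d x, x ∈ A d → proj d x = x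
  proj_of_ne : ∀ d e x, x ∈ A e → e ≠ d → proj d x = 0

/-- The projections of `ℤ_p[u^{±1}]` to its homogeneous pieces. -/
def laurentProjections (p : ℕ) [Fact p.Prime] : Projections (laurentPiece p) where
  -- Since u^k has degree -2k, the piece of degree d consists of the multiples of u^{-d/2} for even
  -- d and is zero for odd d; the integer division is exact whenever it is used.
  proj d :=
    { toFun := fun f => if Even d then LaurentPolynomial.C (f.coeff (-d / 2)) *
        LaurentPolynomial.T (-d / 2) else 0
      map_zero' := by simp
      map_add' := fun f g => by
        split_ifs
        · rw [AddMonoidAlgebra.coeff_add, Finsupp.add_apply, map_add, add_mul]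
        · simp }
  proj_mem d x := by
    intro k hk
    dsimp at hk
    split_ifs at hk with h
    · obtain ⟨c, rfl⟩ := h
      rw [← LaurentPolynomial.single_eq_C_mul_T, AddMonoidAlgebra.coeff_single,
        Finsupp.single_apply] at hk
      split_ifs at hk with h1
      · omega
      · exact absurd rfl hk
    · exact absurd rfl hk
  proj_self d x hx := by
    dsimp
    split_ifs with h
    · ext k
      rw [← LaurentPolynomial.single_eq_C_mul_T, AddMonoidAlgebra.coeff_single,
        Finsupp.single_apply]
      split_ifs with h1
      · rw [h1]
      · by_contra hne
        have := hx k (Ne.symm hne)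
        omega
    · ext k
      by_contra hne
      have := hx k (Ne.symm hne)
      exact h ⟨-k, by omega⟩
  proj_of_ne d e x hx hne := by
    dsimp
    split_ifs with h
    · have : x.coeff (-d / 2) = 0 := by
        by_contra h0
        have := hx _ h0
        obtain ⟨c, rfl⟩ := h
        omega
      rw [this]
      simp
    · rfl

lemma mem_iSup_laurentPiece (p : ℕ) [Fact p.Prime] (x : LaurentPolynomial ℤ_[p]) :
    x ∈ ⨆ d, laurentPiece p d := by
  induction x using LaurentPolynomial.induction_on' with
  | add f g hf hg => exact add_mem hf hg
  | C_mul_T k a =>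
    refine (le_iSup (laurentPiece p) (-2 * k)) fun j hj => ?_
    rw [← LaurentPolynomial.single_eq_C_mul_T, AddMonoidAlgebra.coeff_single,
        Finsupp.single_apply] at hj
    split_ifs at hj with h1
    · rw [h1]
    · exact absurd rfl hj

/-- Coefficientwise projections of a power series ring. -/
def Projections.series {R : Type*} [CommRing R] {A : ℤ → AddSubgroup R} (P : Projections A)
    {σ : Type*} (w : σ → ℤ) : Projections (homogSeries A w) where
  proj d :=
    { toFun := fun f m => P.proj (d - Finsupp.weight w m) (MvPowerSeries.coeff m f)
      map_zero' := by
        funext m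
        rw [map_zero, map_zero]
        rfl
      map_add' := fun f g => by
        funext m
        rw [map_add, map_add]
        rfl }
  proj_mem d f m := P.proj_mem _ _
  proj_self d f hf := by
    funext m
    exact P.proj_self _ _ (hf m)
  proj_of_ne d e f hf hne := by
    funext m
    exact P.proj_of_ne _ _ _ (hf m) (by omega)

lemma Projections.coeff_series_proj {R : Type*} [CommRing R] {A : ℤ → AddSubgroup R}
    (P : Projections A) {σ : Type*} (w : σ → ℤ) (d : ℤ) (f : MvPowerSeries σ R) (m : σ →₀ ℕ) :
    MvPowerSeries.coeff m ((P.series w).proj d f)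
      = P.proj (d - Finsupp.weight w m) (MvPowerSeries.coeff m f) := rfl

/-- The induced projections of the subring of sums of homogeneous elements. -/
def Projections.pieces {S : Type*} [CommRing S] {B : ℤ → AddSubgroup S} [SetLike.GradedMonoid B]
    (P : Projections B) : Projections (pieces B) where
  proj d :=
    { toFun := fun x => ⟨P.proj d x.1, mem_homogSubring B (P.proj_mem d x.1)⟩
      map_zero' := Subtype.ext (map_zero _)
      map_add' := fun _ _ => Subtype.ext (map_add _ _ _) }
  proj_mem d x := P.proj_mem d x.1
  proj_self d x hx := Subtype.ext (P.proj_self d x.1 hx)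
  proj_of_ne d e x hx hne := Subtype.ext (P.proj_of_ne d e x.1 hx hne)

lemma Projections.proj_mul {R : Type*} [CommRing R] {A : ℤ → AddSubgroup R}
    [SetLike.GradedMonoid A] (P : Projections A) {x a : R} (hx : x ∈ ⨆ d, A d) {e : ℤ}
    (ha : a ∈ A e) (d : ℤ) : P.proj d (x * a) = P.proj (d - e) x * a := by
  refine AddSubgroup.iSup_induction A (C := fun x => P.proj d (x * a) = P.proj (d - e) x * a)
    hx (fun i x hx => ?_) (by simp) (fun _ _ hx hy => by
      rw [add_mul, map_add, hx, hy, map_add, add_mul])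
  have hxa := SetLike.GradedMul.mul_mem hx ha
  by_cases h : i + e = d
  · subst h
    rw [P.proj_self _ _ hxa, P.proj_self _ _ (by simpa using hx)]
  · rw [P.proj_of_ne _ _ _ hxa h, P.proj_of_ne _ _ _ hx (by omega), zero_mul]

lemma Projections.exists_eq_sum {S : Type*} [CommRing S] {B : ℤ → AddSubgroup S}
    (P : Projections B) {x : S} (hx : x ∈ ⨆ d, B d) :
    ∃ s : Finset ℤ, x = ∑ d ∈ s, P.proj d x := by
  -- Allowing every larger index set lets the sets of two summands be merged.
  suffices h : ∃ s : Finset ℤ, ∀ t, s ⊆ t → x = ∑ d ∈ t, P.proj d x by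
    obtain ⟨s, hs⟩ := h
    exact ⟨s, hs s subset_rfl⟩
  refine AddSubgroup.iSup_induction B
    (C := fun x => ∃ s : Finset ℤ, ∀ t, s ⊆ t → x = ∑ d ∈ t, P.proj d x)
    hx (fun i x hx => ⟨{i}, fun t ht => ?_⟩) ⟨∅, by simp⟩ ?_
  · rw [Finset.sum_eq_single i, P.proj_self _ _ hx]
    · exact fun d _ hd => P.proj_of_ne _ _ _ hx hd.symm
    · exact fun h => absurd (ht (Finset.mem_singleton_self i)) h
  · rintro x y ⟨s, hs⟩ ⟨s', hs'⟩
    refine ⟨s ∪ s', fun t ht => ?_⟩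
    simp_rw [map_add]
    rw [Finset.sum_add_distrib, ← hs t (Finset.union_subset_left ht),
      ← hs' t (Finset.union_subset_right ht)]

/-- A series, all of whose coefficients lie in an ideal generated by finitely many homogeneous
elements, lies in the ideal generated by the corresponding constants. -/
lemma mem_span_of_coeff_mem {R : Type*} [CommRing R] {A : ℤ → AddSubgroup R}
    [SetLike.GradedMonoid A] (P : Projections A) (hA : ∀ x, x ∈ ⨆ d, A d) {σ : Type*} (w : σ → ℤ)
    {k : ℕ} {a : Fin k → R} {e : Fin k → ℤ} (ha : ∀ i, a i ∈ A (e i))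
    {g : Fin k → homogSubring (homogSeries A w)} (hg : ∀ i, (g i).1 = MvPowerSeries.C (a i))
    (f : homogSubring (homogSeries A w))
    (hf : ∀ m, MvPowerSeries.coeff m f.1 ∈ Ideal.span (Set.range a)) :
    f ∈ Ideal.span (Set.range g) := by
  -- For homogeneous `f`, each multiplier `c m i` is replaced by its component in the only degree
  -- that can contribute. The identity survives because `f` is fixed by its own projection, and for
  -- each `i` the new multipliers form one homogeneous series.
  have homog : ∀ (d : ℤ) (f : homogSubring (homogSeries A w)), f.1 ∈ homogSeries A w d →
      (∀ m, MvPowerSeries.coeff m f.1 ∈ Ideal.span (Set.range a)) →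
      f ∈ Ideal.span (Set.range g) := by
    intro d f hfd hf
    simp_rw [Ideal.mem_span_range_iff_exists_fun] at hf ⊢
    choose c hc using hf
    have hmem : ∀ i, (fun m => P.proj (d - e i - Finsupp.weight w m) (c m i) :
        MvPowerSeries σ R) ∈ homogSeries A w (d - e i) := fun i m => P.proj_mem _ _
    refine ⟨fun i => ⟨_, mem_homogSubring _ (hmem i)⟩, Subtype.ext ?_⟩
    ext m
    rw [AddSubmonoidClass.coe_finsetSum, map_sum, ← P.proj_self _ _ (hfd m), ← hc m, map_sum]
    refine Finset.sum_congr rfl fun i _ => ?_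
    rw [P.proj_mul (hA _) (ha i), Subring.coe_mul, hg, MvPowerSeries.coeff_mul_C, sub_right_comm]
    rfl
  obtain ⟨s, hs⟩ := (P.series w).exists_eq_sum f.2
  have hs' : f = ∑ d ∈ s, (⟨(P.series w).proj d f.1,
      mem_homogSubring _ ((P.series w).proj_mem d f.1)⟩ : homogSubring (homogSeries A w)) := by
    apply Subtype.ext
    rw [AddSubmonoidClass.coe_finsetSum]
    exact hs
  rw [hs']
  refine sum_mem fun d _ => homog d _ ((P.series w).proj_mem d f.1) fun m => ?_
  rw [P.coeff_series_proj]
  have h := hf m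
  rw [Ideal.mem_span_range_iff_exists_fun] at h ⊢
  obtain ⟨c, hc⟩ := h
  refine ⟨fun i => P.proj (d - Finsupp.weight w m - e i) (c i), ?_⟩
  rw [← hc, map_sum]
  exact Finset.sum_congr rfl fun i _ => (P.proj_mul (hA _) (ha i) _).symm

end Projections

section Coefficients

/-! ### The ideals `(v_0, …, v_{k-1})` of `E_n^*` -/

/-- Division of a power series by a variable, discarding the remainder. -/
def divVar {R : Type*} [CommRing R] {σ : Type*} (s : σ) :
    MvPowerSeries σ R →+ MvPowerSeries σ R where
  toFun f m := MvPowerSeries.coeff (m + Finsupp.single s 1) f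
  map_zero' := by
    funext m
    rw [map_zero]
    rfl
  map_add' f g := by
    funext m
    rw [map_add]
    rfl

lemma coeff_divVar {R : Type*} [CommRing R] {σ : Type*} (s : σ) (f : MvPowerSeries σ R)
    (m : σ →₀ ℕ) : MvPowerSeries.coeff m (divVar s f)
      = MvPowerSeries.coeff (m + Finsupp.single s 1) f := rfl

lemma divVar_mem {R : Type*} [CommRing R] {A : ℤ → AddSubgroup R} [SetLike.GradedMonoid A]
    {σ : Type*} {w : σ → ℤ} (s : σ) {f : MvPowerSeries σ R}
    (hf : f ∈ homogSubring (homogSeries A w)) :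
    divVar s f ∈ homogSubring (homogSeries A w) := by
  refine AddSubgroup.iSup_induction (homogSeries A w)
    (C := fun f => divVar s f ∈ homogSubring (homogSeries A w)) hf (fun d f hf => ?_)
    (by rw [map_zero]; exact zero_mem _)
    (fun f g hf hg => by rw [map_add]; exact add_mem hf hg)
  refine mem_homogSubring (d := d - w s) _ fun m => ?_
  have h := hf (m + Finsupp.single s 1)
  rw [map_add, Finsupp.weight_single, one_smul, add_comm, ← sub_sub] at h
  exact h

lemma coeff_single_add_X_mul {R : Type*} [CommRing R] {σ : Type*} (s : σ) (m : σ →₀ ℕ)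
    (f : MvPowerSeries σ R) :
    MvPowerSeries.coeff (Finsupp.single s 1 + m) (MvPowerSeries.X s * f)
      = MvPowerSeries.coeff m f := by
  rw [MvPowerSeries.X, MvPowerSeries.coeff_add_monomial_mul, one_mul]

variable (p n : ℕ) [Fact p.Prime]

lemma v_zero : v p n 0 = p := if_pos rfl

lemma coe_v_succ {i : ℕ} (h : i < n - 1) :
    (v p n (i + 1)).1 = MvPowerSeries.X ⟨i, h⟩ := by
  have h' : i + 1 - 1 < n - 1 := h
  rw [v, if_neg (Nat.succ_ne_zero i), dif_pos h']
  rfl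

lemma v_self (hn : 1 ≤ n) : v p n n = u p n ^ (p ^ n - 1) := by
  rw [v, if_neg (by omega), dif_neg (lt_irrefl _), if_pos rfl]

lemma u_mem : u p n ∈ coeffPiece p n (-2) := by
  have h := C_mem_homogSeries (laurentPiece p) (vDeg p n) (T_mem p 1)
  exact h

lemma v_mem (i : ℕ) : v p n i ∈ coeffPiece p n (-2 * ((p : ℤ) ^ i - 1)) := by
  unfold v
  split_ifs with h0 h1 h2
  · subst h0
    have h : (p : Coeff p n) ∈ SetLike.GradeZero.subring (coeffPiece p n) := natCast_mem _ _
    have e : (-2 * ((p : ℤ) ^ 0 - 1)) = 0 := by ring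
    rw [e]
    exact h
  · have h := X_mem_homogSeries (laurentPiece p) (vDeg p n) ⟨i - 1, h1⟩
    rw [vDeg, show i - 1 + 1 = i by omega] at h
    exact h
  · subst h2
    have h := SetLike.pow_mem_graded (p ^ i - 1) (u_mem p i)
    have hp : 1 ≤ p ^ i := Nat.one_le_pow _ _ (Fact.out : p.Prime).pos
    have e : (p ^ i - 1) • (-2 : ℤ) = -2 * ((p : ℤ) ^ i - 1) := by
      rw [nsmul_eq_mul, Nat.cast_sub hp]
      push_cast
      ring
    rwa [e] at h
  · exact zero_mem _

/-- The ideal `(v_0, …, v_{k-1})` of `E_n^*`. -/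
def vIdeal (k : ℕ) : Ideal (Coeff p n) := Ideal.span (Set.range fun i : Fin k => v p n i)

variable {p n}

lemma v_mem_vIdeal {i k : ℕ} (h : i < k) : v p n i ∈ vIdeal p n k :=
  Ideal.subset_span ⟨⟨i, h⟩, rfl⟩

lemma vIdeal_mono {k l : ℕ} (h : k ≤ l) : vIdeal p n k ≤ vIdeal p n l := by
  rw [vIdeal, Ideal.span_le]
  rintro _ ⟨i, rfl⟩
  exact v_mem_vIdeal (i.2.trans_le h)

lemma mem_vIdeal_one {f : Coeff p n} (hf : ∀ m, MvPowerSeries.coeff m f.1 ∈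
    Ideal.span {(p : LaurentPolynomial ℤ_[p])}) : f ∈ vIdeal p n 1 := by
  refine mem_span_of_coeff_mem (laurentProjections p) (mem_iSup_laurentPiece p) (vDeg p n)
    (a := fun _ => (p : LaurentPolynomial ℤ_[p])) (e := fun _ => 0) (fun _ => ?_) (fun i => ?_)
    f ?_
  · have h : (p : LaurentPolynomial ℤ_[p]) ∈ SetLike.GradeZero.subring (laurentPiece p) :=
      natCast_mem _ _
    exact h
  · rw [Fin.val_eq_zero i, v_zero, map_natCast]
    rfl
  · simpa using hf

/-- `f` lies in `(v_0, …, v_{k-1})` iff the coefficients of its monomials in `v_k, …, v_{n-1}`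
are divisible by `p`. -/
lemma mem_vIdeal_succ_iff {k : ℕ} (hk : k ≤ n - 1) (f : Coeff p n) :
    f ∈ vIdeal p n (k + 1) ↔ ∀ m : Fin (n - 1) →₀ ℕ, (∀ i, i.val < k → m i = 0) →
      MvPowerSeries.coeff m f.1 ∈ Ideal.span {(p : LaurentPolynomial ℤ_[p])} := by
  constructor
  · intro hf
    refine Submodule.span_induction (p := fun f _ => ∀ m : Fin (n - 1) →₀ ℕ,
      (∀ i, i.val < k → m i = 0) →
      MvPowerSeries.coeff m f.1 ∈ Ideal.span {(p : LaurentPolynomial ℤ_[p])})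
      ?_ (fun m _ => by simp) (fun f g _ _ hf hg m hm => ?_) (fun r f _ hf m hm => ?_) hf
    · rintro _ ⟨⟨i, hi⟩, rfl⟩ m hm
      dsimp only
      classical
      cases i with
      | zero =>
        rw [v_zero, show ((p : Coeff p n)).1 = MvPowerSeries.C (p : LaurentPolynomial ℤ_[p]) by
          rw [map_natCast]; rfl, MvPowerSeries.coeff_C]
        split_ifs
        · exact Ideal.mem_span_singleton_self _
        · exact zero_mem _
      | succ i =>
        rw [coe_v_succ p n (by omega : i < n - 1), MvPowerSeries.coeff_X, if_neg]
        · exact zero_mem _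
        · rintro rfl
          have := hm ⟨i, by omega⟩ (by simpa using hi)
          simp at this
    · rw [Subring.coe_add, map_add]
      exact add_mem (hf m hm) (hg m hm)
    · classical
      rw [smul_eq_mul, Subring.coe_mul, MvPowerSeries.coeff_mul]
      refine sum_mem fun x hx => Ideal.mul_mem_left _ _ (hf _ fun i hi => ?_)
      rw [Finset.HasAntidiagonal.mem_antidiagonal] at hx
      have := hm i hi
      rw [← hx, Finsupp.add_apply] at this
      omega
  · induction k generalizing f with
    | zero =>
      intro hf
      exact mem_vIdeal_one fun m => hf m fun i hi => absurd hi (Nat.not_lt_zero _)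
    | succ k ih =>
      intro hf
      have hk' : k < n - 1 := hk
      -- The index `k` stands for v_{k+1}. Subtracting v_{k+1} times the quotient removes every
      -- monomial divisible by v_{k+1} and leaves the others unchanged, so the remainder falls under
      -- the induction hypothesis.
      set g : Coeff p n := ⟨divVar ⟨k, hk'⟩ f.1, divVar_mem _ f.2⟩ with hg
      have h : f - v p n (k + 1) * g ∈ vIdeal p n (k + 1) := by
        refine ih hk'.le _ fun m hm => ?_
        rw [AddSubgroupClass.coe_sub, Subring.coe_mul, map_sub, coe_v_succ p n hk']
        classical
        by_cases h0 : m ⟨k, hk'⟩ = 0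
        · have h1 : MvPowerSeries.coeff m (MvPowerSeries.X ⟨k, hk'⟩ * g.1) = 0 := by
            have hd : MvPowerSeries.X ⟨k, hk'⟩ ∣ MvPowerSeries.X ⟨k, hk'⟩ * g.1 :=
              dvd_mul_right _ _
            exact MvPowerSeries.X_dvd_iff.mp hd m h0
          rw [h1, sub_zero]
          refine hf m fun i hi => ?_
          rcases Nat.lt_succ_iff_lt_or_eq.mp hi with hi | hi
          · exact hm i hi
          · rwa [show i = ⟨k, hk'⟩ from Fin.ext hi]
        · obtain ⟨m', rfl⟩ : ∃ m', m = m' + Finsupp.single ⟨k, hk'⟩ 1 :=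
            ⟨m - Finsupp.single ⟨k, hk'⟩ 1, (tsub_add_cancel_of_le (by
              rw [Finsupp.single_le_iff]; omega)).symm⟩
          rw [add_comm m' (Finsupp.single _ _), coeff_single_add_X_mul, add_comm, hg, coeff_divVar,
            sub_self]
          exact zero_mem _
      have := add_mem (vIdeal_mono (Nat.le_succ _) h)
        (Ideal.mul_mem_right g _ (v_mem_vIdeal (p := p) (n := n) (Nat.lt_succ_self (k + 1))))
      simpa using this

lemma coeff_natCast_mul (k : ℤ) (f : LaurentPolynomial ℤ_[p]) :
    ((p : LaurentPolynomial ℤ_[p]) * f).coeff k = p * f.coeff k := by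
  rw [← nsmul_eq_mul, ← nsmul_eq_mul, AddMonoidAlgebra.coeff_smul, Finsupp.smul_apply]

lemma natCast_p_mul_eq_zero {f : LaurentPolynomial ℤ_[p]}
    (h : (p : LaurentPolynomial ℤ_[p]) * f = 0) : f = 0 := by
  have hp : (p : ℤ_[p]) ≠ 0 := Nat.cast_ne_zero.mpr (Fact.out : p.Prime).ne_zero
  ext k
  have h' := congrArg (fun g : LaurentPolynomial ℤ_[p] => g.coeff k) h
  rw [coeff_natCast_mul] at h'
  exact (mul_eq_zero.mp h').resolve_left hp

/-- `v_0, …, v_{n-1}` is a regular sequence in `E_n^*`. -/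
lemma mem_vIdeal_of_v_mul_mem {k : ℕ} (hk : k < n) {f : Coeff p n}
    (hf : v p n k * f ∈ vIdeal p n k) : f ∈ vIdeal p n k := by
  cases k with
  | zero =>
    have h0 : vIdeal p n 0 = ⊥ := by
      rw [vIdeal, Set.range_eq_empty, Ideal.span_empty]
    rw [h0, Ideal.mem_bot, v_zero] at hf
    rw [h0, Ideal.mem_bot]
    refine Subtype.ext (MvPowerSeries.ext fun m => natCast_p_mul_eq_zero ?_)
    have h := congrArg (fun g : Coeff p n => MvPowerSeries.coeff m g.1) hf
    rw [← nsmul_eq_mul, AddSubmonoidClass.coe_nsmul, map_nsmul, nsmul_eq_mul] at h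
    exact h
  | succ k =>
    have hk' : k < n - 1 := by omega
    rw [mem_vIdeal_succ_iff hk'.le] at hf ⊢
    intro m hm
    -- Multiplication by the variable shifts exponents, and the shifted monomial still avoids v_1,
    -- …, v_k.
    have h := hf (Finsupp.single ⟨k, hk'⟩ 1 + m) fun i hi => by
      rw [Finsupp.add_apply, hm i hi, Finsupp.single_eq_of_ne, add_zero]
      rintro rfl
      exact lt_irrefl _ hi
    rwa [Subring.coe_mul, coe_v_succ p n hk', coeff_single_add_X_mul] at h

/-- The constant coefficient 1 is not divisible by p. This is the source of nonvanishing in the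
periodicity claim. -/
lemma one_notMem_vIdeal (hn : 1 ≤ n) : (1 : Coeff p n) ∉ vIdeal p n n := by
  intro h
  obtain ⟨k, rfl⟩ := Nat.exists_eq_add_of_le' hn
  have h1 := (mem_vIdeal_succ_iff (by omega) _).mp h 0 (fun _ _ => rfl)
  rw [Subring.coe_one, MvPowerSeries.coeff_zero_one, Ideal.mem_span_singleton] at h1
  obtain ⟨g, hg⟩ := h1
  have h2 := congrArg (fun g : LaurentPolynomial ℤ_[p] => g.coeff 0) hg
  rw [coeff_natCast_mul] at h2
  have h3 : (1 : ℤ_[p]) = p * g.coeff 0 := by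
    rw [← h2, ← LaurentPolynomial.T_zero, LaurentPolynomial.T_apply, if_pos rfl]
  exact (PadicInt.prime_p (p := p)).not_isUnit (IsUnit.of_mul_eq_one _ h3.symm)

end Coefficients

section PSeries

/-! ### The leading term of the `p`-series -/

/-- Adding a point of an ideal does not change a point modulo that ideal. -/
lemma subst_sub_mem_of_left {R : Type*} [CommRing R] (F : FormalGroup R) {σ : Type*}
    {J : Ideal (MvPowerSeries σ R)} {f g : MvPowerSeries σ R} (hf : PowerSeries.HasSubst f)
    (hg : PowerSeries.HasSubst g) (hfJ : f ∈ J) : F.toPowerSeries.subst ![f, g] - g ∈ J := by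
  have hX1 : PowerSeries.HasSubst (MvPowerSeries.X 1 : MvPowerSeries (Fin 2) R) :=
    PowerSeries.HasSubst.of_constantCoeff_zero (by simp)
  -- F(0, y) = y says that F(x, y) - y has no monomial free of x, so F(x, y) = y + x H(x, y).
  -- Substituting gives F(f, g) - g = f H(f, g), which lies in J.
  obtain ⟨H, hH⟩ : MvPowerSeries.X 0 ∣ F.toPowerSeries - MvPowerSeries.X 1 := by
    rw [MvPowerSeries.X_dvd_iff]
    intro m hm
    have hs : MvPowerSeries.HasSubst ![(0 : MvPowerSeries (Fin 2) R), MvPowerSeries.X 1] :=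
      MvPowerSeries.hasSubst_of_constantCoeff_nilpotent fun s => by fin_cases s <;> simp
    have h := congrArg (MvPowerSeries.coeff m) (F.zero_add hX1)
    rw [MvPowerSeries.coeff_subst hs, finsum_eq_single _ m] at h
    · have hprod : (m.prod fun s e => ![(0 : MvPowerSeries (Fin 2) R), MvPowerSeries.X 1] s ^ e)
          = MvPowerSeries.monomial m 1 := by
        rw [Finsupp.prod_fintype _ _ (by simp), Fin.prod_univ_two, hm]
        simp only [Matrix.cons_val_zero, Matrix.cons_val_one, pow_zero, one_mul]
        have hm' : Finsupp.single 1 (m 1) = m := by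
          ext i
          fin_cases i <;> simp [hm]
        rw [MvPowerSeries.X_pow_eq, hm']
      rw [hprod, MvPowerSeries.coeff_monomial_same, smul_eq_mul, mul_one] at h
      rw [map_sub, h, sub_self]
    · intro d hd
      rw [Finsupp.prod_fintype _ _ (by simp), Fin.prod_univ_two]
      simp only [Matrix.cons_val_zero, Matrix.cons_val_one]
      classical
      by_cases hd0 : d 0 = 0
      · rw [hd0, pow_zero, one_mul, MvPowerSeries.coeff_X_pow, if_neg, smul_zero]
        intro h1
        apply hd
        ext i
        fin_cases i
        · simp [hd0, hm]
        · simp [h1]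
      · rw [zero_pow hd0, zero_mul, map_zero, smul_zero]
  have hs : MvPowerSeries.HasSubst ![f, g] :=
    MvPowerSeries.hasSubst_of_constantCoeff_nilpotent fun s => by
      fin_cases s
      · exact hf
      · exact hg
  have h : F.toPowerSeries = MvPowerSeries.X 1 + MvPowerSeries.X 0 * H := by
    rw [← hH]; ring
  rw [h, MvPowerSeries.subst_add hs, MvPowerSeries.subst_mul hs, MvPowerSeries.subst_X hs,
    MvPowerSeries.subst_X hs]
  simpa using Ideal.mul_mem_right _ J hfJ

/-- The ideal of power series whose coefficients of degree at most `N` lie in `I`. -/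
def lowIdeal {R : Type*} [CommRing R] (I : Ideal R) (N : ℕ) : Ideal (PowerSeries R) where
  carrier := {f | ∀ j ≤ N, PowerSeries.coeff j f ∈ I}
  zero_mem' j _ := by simp
  add_mem' hf hg j hj := by rw [map_add]; exact add_mem (hf j hj) (hg j hj)
  smul_mem' r f hf j hj := by
    rw [smul_eq_mul, PowerSeries.coeff_mul]
    refine sum_mem fun x hx => Ideal.mul_mem_left _ _ (hf _ ?_)
    rw [Finset.HasAntidiagonal.mem_antidiagonal] at hx
    omega

/-- Formal summands lying in J do not change the sum mod J, so the partial sums are 0 mod J until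
the k-th term enters and equal to that term afterwards. Commutativity is used to put the summand
from J on the left. -/
lemma list_sum_mem_sub {R : Type*} [CommRing R] (F : FormalGroup R) [F.IsComm]
    {J : Ideal (PowerSeries R)} {t : ℕ → F.Point Unit} {k : ℕ}
    (ht : ∀ i, i ≠ k → ((t i).val : PowerSeries R) ∈ J) (N : ℕ) :
    (N ≤ k → ((((List.range N).map t).sum : F.Point Unit).val : PowerSeries R) ∈ J) ∧
    (k < N → ((((List.range N).map t).sum : F.Point Unit).val - (t k).val : PowerSeries R) ∈ J)
    := by
  induction N with
  | zero => exact ⟨fun _ => J.zero_mem, fun h => absurd h (Nat.not_lt_zero _)⟩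
  | succ N ih =>
    rw [List.range_succ, List.map_append, List.sum_append, List.map_singleton, List.sum_singleton]
    set s : F.Point Unit := ((List.range N).map t).sum
    have hleft : (s.val : PowerSeries R) ∈ J → ((s + t N).val - (t N).val : PowerSeries R) ∈ J :=
      fun h => subst_sub_mem_of_left F s.2 (t N).2 h
    have hright : ((t N).val : PowerSeries R) ∈ J → ((s + t N).val - s.val : PowerSeries R) ∈ J :=
      fun h => by
        rw [add_comm]
        exact subst_sub_mem_of_left F (t N).2 s.2 h
    refine ⟨fun h => ?_, fun h => ?_⟩
    · have h1 := ht N (by omega)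
      have h2 := add_mem (hright h1) (ih.1 (by omega))
      rwa [sub_add_cancel] at h2
    · rcases Nat.lt_succ_iff_lt_or_eq.mp h with h | rfl
      · have h2 := add_mem (hright (ht N h.ne')) (ih.2 h)
        rwa [sub_add_sub_cancel] at h2
      · exact hleft (ih.1 le_rfl)

variable {p n : ℕ} [Fact p.Prime] {F : FormalGroup (Coeff p n)}

/-- Only the formal summand with i = k survives: for i < k its coefficient lies in I_k, and for i >
k its exponent p^i exceeds p^k. -/
lemma pSeries_sub_mem (hF : IsMoravaFormalGroup p n F) {k : ℕ} (hk : k ≤ n) :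
    (mSeries F p - PowerSeries.C (v p n k) * PowerSeries.X ^ p ^ k : PowerSeries (Coeff p n))
      ∈ lowIdeal (vIdeal p n k) (p ^ k) := by
  have := hF.comm
  have hp := (Fact.out : p.Prime)
  rw [hF.pSeries_eq]
  refine (list_sum_mem_sub F (J := lowIdeal (vIdeal p n k) (p ^ k)) (t := fun i => monomialPoint F (v p n i) (p ^ i)
    (pow_ne_zero i hp.ne_zero)) (k := k) (fun i hi j hj => ?_) (n + 1)).2 (by omega)
  change PowerSeries.coeff j (PowerSeries.C (v p n i) * PowerSeries.X ^ p ^ i) ∈ _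
  rw [PowerSeries.coeff_C_mul, PowerSeries.coeff_X_pow]
  rcases lt_or_gt_of_ne hi with h | h
  · exact Ideal.mul_mem_right _ _ (v_mem_vIdeal h)
  · rw [if_neg, mul_zero]
    · exact zero_mem _
    · exact (hj.trans_lt (Nat.pow_lt_pow_right hp.one_lt h)).ne

lemma coeff_pSeries_mem (hF : IsMoravaFormalGroup p n F) {k j : ℕ} (hk : k ≤ n) (hj : j < p ^ k) :
    PowerSeries.coeff j (mSeries F p) ∈ vIdeal p n k := by
  have h := pSeries_sub_mem hF hk j hj.le
  rwa [map_sub, PowerSeries.coeff_C_mul, PowerSeries.coeff_X_pow, if_neg hj.ne, mul_zero,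
    sub_zero] at h

lemma coeff_pSeries_sub_mem (hF : IsMoravaFormalGroup p n F) {k : ℕ} (hk : k ≤ n) :
    PowerSeries.coeff (p ^ k) (mSeries F p) - v p n k ∈ vIdeal p n k := by
  have h := pSeries_sub_mem hF hk _ le_rfl
  rwa [map_sub, PowerSeries.coeff_C_mul, PowerSeries.coeff_X_pow, if_pos rfl, mul_one] at h

end PSeries

section Series

/-! ### Regularity in `E_n^*[[y]]` -/

lemma mem_homogSeries_iff {R : Type*} [CommRing R] (A : ℤ → AddSubgroup R) (w d : ℤ)
    (f : PowerSeries R) : f ∈ homogSeries A (fun _ : Unit => w) d ↔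
      ∀ j : ℕ, PowerSeries.coeff j f ∈ A (d - j * w) := by
  constructor
  · intro h j
    have := h (Finsupp.single () j)
    rwa [Finsupp.weight_single, nsmul_eq_mul] at this
  · intro h m
    obtain ⟨j, rfl⟩ : ∃ j, m = Finsupp.single () j := ⟨m (), Finsupp.unique_single m⟩
    rw [Finsupp.weight_single, nsmul_eq_mul]
    exact h j

/-- The recursion for the coefficients of the inverse respects degrees. This keeps the inverse
inside the graded series ring. -/
lemma invOfUnit_mem_homogSeries {R : Type*} [CommRing R] {A : ℤ → AddSubgroup R}
    [SetLike.GradedMonoid A] {w d : ℤ} {f : PowerSeries R}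
    (hf : f ∈ homogSeries A (fun _ : Unit => w) d) {c : Rˣ} (hc : ((c⁻¹ : Rˣ) : R) ∈ A (-d)) :
    PowerSeries.invOfUnit f c ∈ homogSeries A (fun _ : Unit => w) (-d) := by
  rw [mem_homogSeries_iff] at hf ⊢
  intro j
  induction j using Nat.strong_induction_on with
  | _ j ih =>
    rw [PowerSeries.coeff_invOfUnit]
    split_ifs with h
    · subst h
      simpa using hc
    · have hsum : ∑ x ∈ Finset.HasAntidiagonal.antidiagonal j, (if x.2 < j then
          PowerSeries.coeff x.1 f * PowerSeries.coeff x.2 (PowerSeries.invOfUnit f c) else 0)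
          ∈ A (-(j * w)) := by
        refine sum_mem fun x hx => ?_
        split_ifs with hx2
        · have h1 := SetLike.GradedMul.mul_mem (hf x.1) (ih x.2 hx2)
          rw [Finset.HasAntidiagonal.mem_antidiagonal] at hx
          have e : d - x.1 * w + (-d - x.2 * w) = -(j * w) := by
            rw [← hx]; push_cast; ring
          rwa [e] at h1
        · exact zero_mem _
      have h1 := SetLike.GradedMul.mul_mem hc hsum
      rw [← sub_eq_add_neg] at h1
      rw [neg_mul]
      exact neg_mem h1

/-- The lowest coefficient of a product modulo an ideal. -/
lemma coeff_add_mul_sub_mem {R : Type*} [CommRing R] {I : Ideal R} {f g : PowerSeries R} {a b : ℕ}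
    (hf : ∀ j < a, PowerSeries.coeff j f ∈ I) (hg : ∀ j < b, PowerSeries.coeff j g ∈ I) :
    PowerSeries.coeff (a + b) (f * g) - PowerSeries.coeff a f * PowerSeries.coeff b g ∈ I := by
  have hab : (a, b) ∈ Finset.HasAntidiagonal.antidiagonal (a + b) := by
    rw [Finset.HasAntidiagonal.mem_antidiagonal]
  rw [PowerSeries.coeff_mul, ← Finset.add_sum_erase _ _ hab, add_sub_cancel_left]
  refine sum_mem fun x hx => ?_
  rw [Finset.mem_erase, Finset.HasAntidiagonal.mem_antidiagonal] at hx
  rcases lt_trichotomy x.1 a with h | h | h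
  · exact Ideal.mul_mem_right _ _ (hf _ h)
  · exact absurd (Prod.ext h (by omega)) hx.1
  · exact Ideal.mul_mem_left _ _ (hg _ (by omega))

lemma mem_sup_span_singleton_iff {R : Type*} [CommRing R] {I : Ideal R} {a x : R} :
    x ∈ I ⊔ Ideal.span {a} ↔ ∃ g, x - a * g ∈ I := by
  constructor
  · intro h
    obtain ⟨b, hb, c, hc, rfl⟩ := Submodule.mem_sup.mp h
    obtain ⟨g, rfl⟩ := Ideal.mem_span_singleton.mp hc
    exact ⟨g, by rwa [add_sub_cancel_right]⟩
  · rintro ⟨g, hg⟩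
    exact Submodule.mem_sup.mpr ⟨_, hg, a * g, Ideal.mem_span_singleton.mpr (dvd_mul_right _ _),
      sub_add_cancel _ _⟩

variable (p n : ℕ) [Fact p.Prime]

/-- The ideal `(v_0, …, v_{k-1})` of `E_n^*[[y]]`. -/
def vSeriesIdeal (k : ℕ) : Ideal (SeriesRing p n) :=
  Ideal.span (Set.range fun i : Fin k => coeffMap p n (v p n i))

variable {p n}

lemma coe_coeffMap (x : Coeff p n) : (coeffMap p n x).1 = MvPowerSeries.C x := rfl

lemma coeff_coeffMap_mul (x : Coeff p n) (f : SeriesRing p n) (j : ℕ) :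
    PowerSeries.coeff j (coeffMap p n x * f).1 = x * PowerSeries.coeff j f.1 :=
  PowerSeries.coeff_C_mul j f.1 x

lemma coeff_y_pow (N j : ℕ) :
    PowerSeries.coeff j ((y p n) ^ N).1 = if j = N then 1 else 0 :=
  PowerSeries.coeff_X_pow j N

lemma coeff_y_pow_mul (N j : ℕ) (f : SeriesRing p n) :
    PowerSeries.coeff j ((y p n) ^ N * f).1 = if N ≤ j then PowerSeries.coeff (j - N) f.1 else 0 :=
  PowerSeries.coeff_X_pow_mul' f.1 N j

/-- Reduces questions mod I_k to coefficients. The converse direction depends on I_k having finitely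
many homogeneous generators. -/
lemma mem_vSeriesIdeal_iff {k : ℕ} {f : SeriesRing p n} :
    f ∈ vSeriesIdeal p n k ↔ ∀ j, PowerSeries.coeff j f.1 ∈ vIdeal p n k := by
  constructor
  · intro hf
    refine Submodule.span_induction (p := fun f _ => ∀ j, PowerSeries.coeff j f.1 ∈ vIdeal p n k)
      ?_ (fun j => zero_mem _) (fun f g _ _ hf hg j => ?_) (fun r f _ hf j => ?_) hf
    · rintro _ ⟨i, rfl⟩ j
      have h := coeff_coeffMap_mul (v p n i) 1 j
      rw [mul_one] at h
      dsimp only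
      rw [h]
      exact Ideal.mul_mem_right _ _ (v_mem_vIdeal i.2)
    · rw [Subring.coe_add, map_add]
      exact add_mem (hf j) (hg j)
    · rw [smul_eq_mul, Subring.coe_mul, PowerSeries.coeff_mul]
      exact sum_mem fun x _ => Ideal.mul_mem_left _ _ (hf _)
  · intro hf
    refine mem_span_of_coeff_mem ((laurentProjections p).series (vDeg p n)).pieces
      (mem_iSup_pieces _) (fun _ : Unit => 2) (a := fun i : Fin k => v p n i)
      (fun i => v_mem p n i) (fun i => coe_coeffMap _) f fun m => ?_
    obtain ⟨j, rfl⟩ : ∃ j, m = Finsupp.single () j := ⟨m (), Finsupp.unique_single m⟩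
    exact hf j

lemma vSeriesIdeal_mono {k l : ℕ} (h : k ≤ l) : vSeriesIdeal p n k ≤ vSeriesIdeal p n l :=
  fun _ hf => mem_vSeriesIdeal_iff.mpr fun j => vIdeal_mono h (mem_vSeriesIdeal_iff.mp hf j)

lemma mem_vSeriesIdeal_succ {k : ℕ} {f : SeriesRing p n} (hf : f ∈ vSeriesIdeal p n (k + 1)) :
    ∃ g, f - coeffMap p n (v p n k) * g ∈ vSeriesIdeal p n k := by
  rw [← mem_sup_span_singleton_iff]
  refine (Ideal.span_le.mpr ?_ : vSeriesIdeal p n (k + 1) ≤ _) hf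
  rintro _ ⟨i, rfl⟩
  rcases Nat.lt_succ_iff_lt_or_eq.mp i.2 with h | h
  · exact Ideal.mem_sup_left (Ideal.subset_span ⟨⟨i, h⟩, rfl⟩)
  · refine Ideal.mem_sup_right (Ideal.subset_span ?_)
    rw [Set.mem_singleton_iff]
    exact congrArg (fun j => coeffMap p n (v p n j)) h

lemma mem_vSeriesIdeal_of_v_mul_mem {k : ℕ} (hk : k < n) {f : SeriesRing p n}
    (hf : coeffMap p n (v p n k) * f ∈ vSeriesIdeal p n k) : f ∈ vSeriesIdeal p n k := by
  rw [mem_vSeriesIdeal_iff] at hf ⊢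
  intro j
  refine mem_vIdeal_of_v_mul_mem hk ?_
  rw [← coeff_coeffMap_mul]
  exact hf j

variable {F : FormalGroup (Coeff p n)} (hF : IsMoravaFormalGroup p n F)

/-- Mod I_k the series [p](y) starts with v_k y^{p^k}, so it moves the lowest term of `g` up by p^k
and multiplies its coefficient by v_k. -/
lemma coeff_pSeries_mul_sub_mem {k : ℕ} (hk : k ≤ n) {g : SeriesRing p n} {b : ℕ}
    (hg : ∀ j < b, PowerSeries.coeff j g.1 ∈ vIdeal p n k) :
    PowerSeries.coeff (p ^ k + b) (pSeries hF * g).1 - v p n k * PowerSeries.coeff b g.1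
      ∈ vIdeal p n k := by
  have h1 := coeff_add_mul_sub_mem (fun j hj => coeff_pSeries_mem hF hk hj) hg
  have h2 := Ideal.mul_mem_right (PowerSeries.coeff b g.1) _ (coeff_pSeries_sub_mem hF hk)
  have h3 := add_mem h1 h2
  rw [sub_mul, sub_add_sub_cancel] at h3
  exact h3

/-- The `p`-series is a nonzerodivisor modulo `(v_0, …, v_{k-1})` for `k < n`. -/
lemma mem_vSeriesIdeal_of_pSeries_mul_mem {k : ℕ} (hk : k < n) {g : SeriesRing p n}
    (hg : pSeries hF * g ∈ vSeriesIdeal p n k) : g ∈ vSeriesIdeal p n k := by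
  rw [mem_vSeriesIdeal_iff] at hg ⊢
  intro b
  induction b using Nat.strong_induction_on with
  | _ b ih =>
    refine mem_vIdeal_of_v_mul_mem hk ?_
    have h := sub_mem (hg (p ^ k + b)) (coeff_pSeries_mul_sub_mem hF hk.le ih)
    rwa [sub_sub_cancel] at h

/-- `v_k` is a nonzerodivisor on `E_n^*(BC_p)/(v_0, …, v_{k-1})` for `k < n - 1`. -/
lemma mem_sup_of_v_mul_mem {k : ℕ} (hk : k + 1 < n) {f : SeriesRing p n}
    (hf : coeffMap p n (v p n k) * f ∈ vSeriesIdeal p n k ⊔ Ideal.span {pSeries hF}) :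
    f ∈ vSeriesIdeal p n k ⊔ Ideal.span {pSeries hF} := by
  rw [mem_sup_span_singleton_iff] at hf ⊢
  obtain ⟨g, hg⟩ := hf
  have hv : coeffMap p n (v p n k) * f ∈ vSeriesIdeal p n (k + 1) :=
    Ideal.mul_mem_right _ _ (Ideal.subset_span ⟨Fin.last k, rfl⟩)
  -- Mod I_{k+1} the left side of v_k f ≡ [p](y) g vanishes, and [p](y) is regular there because k +
  -- 1 < n. Hence g ≡ v_k g' mod I_k, and v_k can be cancelled from v_k (f - [p](y) g').
  have hPg : pSeries hF * g ∈ vSeriesIdeal p n (k + 1) := by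
    have h := sub_mem hv (vSeriesIdeal_mono (Nat.le_succ k) hg)
    rwa [sub_sub_cancel] at h
  obtain ⟨g', hg'⟩ := mem_vSeriesIdeal_succ (mem_vSeriesIdeal_of_pSeries_mul_mem hF hk hPg)
  refine ⟨g', mem_vSeriesIdeal_of_v_mul_mem (by omega) ?_⟩
  have h := add_mem hg (Ideal.mul_mem_left _ (pSeries hF) hg')
  convert h using 1
  ring

/-- No power of `y` vanishes in `E_n^*(BC_p)/(v_0, …, v_{n-2})`. -/
lemma y_pow_notMem (hn : 1 ≤ n) (N : ℕ) :
    y p n ^ N ∉ vSeriesIdeal p n (n - 1) ⊔ Ideal.span {pSeries hF} := by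
  rw [mem_sup_span_singleton_iff]
  rintro ⟨g, hg⟩
  have hone : (1 : Coeff p n) ∉ vIdeal p n (n - 1) :=
    fun h => one_notMem_vIdeal hn (vIdeal_mono (Nat.sub_le _ _) h)
  rw [mem_vSeriesIdeal_iff] at hg
  simp_rw [AddSubgroupClass.coe_sub, map_sub, coeff_y_pow] at hg
  -- Let b be the order of `g` mod I_{n-1}, with leading coefficient c. In degree p^{n-1} + b the
  -- relation reads v_{n-1} c ≡ 1 or 0. The first would put 1 in I_n, the second contradicts
  -- regularity of v_{n-1}. If `g` vanishes mod I_{n-1}, so does y^N, which is absurd.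
  by_cases hall : ∃ b, PowerSeries.coeff b g.1 ∉ vIdeal p n (n - 1)
  · classical
    have hmin := fun j (hj : j < Nat.find hall) => not_not.mp (Nat.find_min hall hj)
    have hb := Nat.find_spec hall
    set b := Nat.find hall
    have h := add_mem (hg (p ^ (n - 1) + b))
      (coeff_pSeries_mul_sub_mem hF (Nat.sub_le n 1) hmin)
    rw [sub_add_sub_cancel] at h
    split_ifs at h with hN
    · refine one_notMem_vIdeal (p := p) hn ?_
      have h1 := add_mem (vIdeal_mono (Nat.sub_le n 1) h) (Ideal.mul_mem_right
        (PowerSeries.coeff b g.1) _ (v_mem_vIdeal (p := p) (n := n) (by omega : n - 1 < n)))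
      rwa [sub_add_cancel] at h1
    · rw [zero_sub] at h
      exact hb (mem_vIdeal_of_v_mul_mem (by omega) (neg_mem_iff.mp h))
  · push Not at hall
    have h1 : pSeries hF * g ∈ vSeriesIdeal p n (n - 1) :=
      Ideal.mul_mem_left _ _ (mem_vSeriesIdeal_iff.mpr hall)
    have h := add_mem (hg N) (mem_vSeriesIdeal_iff.mp h1 N)
    rw [sub_add_cancel, if_pos rfl] at h
    exact hone h

variable (p n) in
lemma exists_u_inv : ∃ t ∈ coeffPiece p n 2, u p n * t = 1 := by
  refine ⟨⟨MvPowerSeries.C (LaurentPolynomial.T (-1)),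
    mem_homogSubring _ (C_mem_homogSeries _ _ (T_mem p (-1)))⟩,
    C_mem_homogSeries (laurentPiece p) (vDeg p n) (T_mem p (-1)), Subtype.ext ?_⟩
  rw [Subring.coe_mul, u, ← map_mul, ← LaurentPolynomial.T_add]
  simp

/-- The class of `y` is nilpotent in `E_n^*(BC_p)/(v_0, …, v_{n-1})`. -/
lemma y_pow_mem (hn : 1 ≤ n) :
    y p n ^ p ^ n ∈ vSeriesIdeal p n n ⊔ Ideal.span {pSeries hF} := by
  obtain ⟨t, ht, hut⟩ := exists_u_inv p n
  let c : (Coeff p n)ˣ := ⟨u p n ^ (p ^ n - 1), t ^ (p ^ n - 1), by rw [← mul_pow, hut, one_pow],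
    by rw [← mul_pow, mul_comm, hut, one_pow]⟩
  have hp : 1 ≤ p ^ n := Nat.one_le_pow _ _ (Fact.out : p.Prime).pos
  have hc : ((c⁻¹ : (Coeff p n)ˣ) : Coeff p n) ∈ coeffPiece p n (-(-2 * ((p : ℤ) ^ n - 1))) := by
    have h := SetLike.pow_mem_graded (p ^ n - 1) ht
    have e : (p ^ n - 1) • (2 : ℤ) = -(-2 * ((p : ℤ) ^ n - 1)) := by
      rw [nsmul_eq_mul, Nat.cast_sub hp]
      push_cast
      ring
    rwa [e] at h
  have hP := (mem_homogSeries_iff _ _ _ _).mp (mSeries_mem hF p)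
  -- This is [p](y) with its terms below y^{p^n} dropped, divided by y^{p^n}. Its constant term is
  -- set to v_n exactly, not just mod I_n, so that it is visibly a unit; the change lies in I_n.
  let q : PowerSeries (Coeff p n) := PowerSeries.mk fun j =>
    if j = 0 then v p n n else PowerSeries.coeff (j + p ^ n) (mSeries F p)
  have hq : q ∈ homogSeries (coeffPiece p n) (fun _ : Unit => 2) (-2 * ((p : ℤ) ^ n - 1)) := by
    rw [mem_homogSeries_iff]
    intro j
    rw [PowerSeries.coeff_mk]
    split_ifs with h
    · subst h
      simpa using v_mem p n n
    · have h := hP (j + p ^ n)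
      have e : (2 : ℤ) - ((j + p ^ n : ℕ) : ℤ) * 2 = -2 * ((p : ℤ) ^ n - 1) - j * 2 := by
        push_cast
        ring
      rwa [e] at h
  let Q : SeriesRing p n := ⟨q, mem_homogSubring _ hq⟩
  let Q' : SeriesRing p n := ⟨_, mem_homogSubring _ (invOfUnit_mem_homogSeries hq hc)⟩
  have hQ : Q * Q' = 1 := by
    refine Subtype.ext (PowerSeries.mul_invOfUnit q c ?_)
    rw [← PowerSeries.coeff_zero_eq_constantCoeff_apply, PowerSeries.coeff_mk, if_pos rfl,
      v_self p n hn]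
  have hmem : y p n ^ p ^ n * Q - pSeries hF ∈ vSeriesIdeal p n n := by
    rw [mem_vSeriesIdeal_iff]
    intro j
    rw [AddSubgroupClass.coe_sub, map_sub, coeff_y_pow_mul]
    change (if _ then PowerSeries.coeff _ q else 0) - PowerSeries.coeff j (mSeries F p) ∈ _
    split_ifs with h
    · rw [PowerSeries.coeff_mk]
      split_ifs with h0
      · obtain rfl : j = p ^ n := by omega
        rw [← neg_sub]
        exact neg_mem (coeff_pSeries_sub_mem hF le_rfl)
      · rw [Nat.sub_add_cancel h, sub_self]
        exact zero_mem _
    · rw [zero_sub]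
      exact neg_mem (coeff_pSeries_mem hF le_rfl (not_le.mp h))
  rw [mem_sup_span_singleton_iff]
  refine ⟨Q', ?_⟩
  have h := Ideal.mul_mem_right Q' _ hmem
  rwa [sub_mul, mul_assoc, hQ, mul_one] at h

end Series

section Localization

/-! ### Inverting `y` -/

variable {p n : ℕ} [Fact p.Prime]

lemma seriesToLaurent_injective : Function.Injective (seriesToLaurent p n) := fun _ _ h =>
  Subtype.ext (HahnSeries.ofPowerSeries_injective (congrArg Subtype.val h))

lemma coe_seriesToLaurent (f : SeriesRing p n) :
    (seriesToLaurent p n f).1 = HahnSeries.ofPowerSeries ℤ (Coeff p n) f.1 := rfl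

lemma coe_seriesToLaurent_y_pow (N : ℕ) :
    (seriesToLaurent p n (y p n ^ N)).1 = HahnSeries.single (N : ℤ) 1 := by
  rw [coe_seriesToLaurent, Subring.coe_pow]
  exact HahnSeries.ofPowerSeries_X_pow N

lemma isUnit_seriesToLaurent_y : IsUnit (seriesToLaurent p n (y p n)) := by
  have hmem : (HahnSeries.single (-1 : ℤ) (1 : Coeff p n)) ∈
      homogLaurent (coeffPiece p n) 2 (-2) := by
    intro k
    rw [HahnSeries.coeff_single]
    split_ifs with h
    · subst h
      exact SetLike.GradedOne.one_mem (A := coeffPiece p n)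
    · exact zero_mem _
  refine IsUnit.of_mul_eq_one ⟨_, mem_homogSubring _ hmem⟩ (Subtype.ext ?_)
  have h := coe_seriesToLaurent_y_pow (p := p) (n := n) 1
  rw [pow_one] at h
  rw [Subring.coe_mul, h, HahnSeries.single_mul_single, mul_one, Nat.cast_one, add_neg_cancel]
  rfl

/-- A homogeneous Laurent series has bounded pole order, and a finite sum of them has a common
bound. -/
lemma exists_seriesToLaurent_eq (l : LaurentRing p n) :
    ∃ (N : ℕ) (f : SeriesRing p n), seriesToLaurent p n (y p n ^ N) * l = seriesToLaurent p n f := by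
  obtain ⟨l, hl⟩ := l
  suffices h : ∃ (N : ℕ) (f : SeriesRing p n),
      (seriesToLaurent p n (y p n ^ N)).1 * l = (seriesToLaurent p n f).1 by
    obtain ⟨N, f, h⟩ := h
    exact ⟨N, f, Subtype.ext h⟩
  refine AddSubgroup.iSup_induction (homogLaurent (coeffPiece p n) 2)
    (C := fun l => ∃ (N : ℕ) (f : SeriesRing p n),
      (seriesToLaurent p n (y p n ^ N)).1 * l = (seriesToLaurent p n f).1) hl
    (fun d l hl => ?_) ⟨0, 0, by rw [mul_zero, map_zero]; rfl⟩ ?_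
  · have hs : l.powerSeriesPart ∈
        homogSeries (coeffPiece p n) (fun _ : Unit => 2) (d - l.order * 2) := by
      rw [mem_homogSeries_iff]
      intro j
      rw [LaurentSeries.powerSeriesPart_coeff, sub_sub, ← add_mul]
      exact hl _
    -- The order may have either sign: its negative part clears the pole, its positive part is a
    -- factor of the resulting power series.
    refine ⟨(-l.order).toNat, y p n ^ l.order.toNat * ⟨_, mem_homogSubring _ hs⟩, ?_⟩
    rw [map_mul, Subring.coe_mul, coe_seriesToLaurent_y_pow, coe_seriesToLaurent_y_pow,
      coe_seriesToLaurent, LaurentSeries.ofPowerSeries_powerSeriesPart, ← mul_assoc,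
      HahnSeries.single_mul_single, mul_one]
    congr 3
    omega
  · rintro l l' ⟨N, f, h⟩ ⟨N', f', h'⟩
    refine ⟨N + N', y p n ^ N' * f + y p n ^ N * f', ?_⟩
    rw [map_add, map_mul, map_mul, Subring.coe_add, Subring.coe_mul, Subring.coe_mul, ← h, ← h',
      pow_add, map_mul, Subring.coe_mul]
    ring

variable {F : FormalGroup (Coeff p n)} (hF : IsMoravaFormalGroup p n F)

lemma toCohomology_surjective : Function.Surjective (toCohomology hF) :=
  Ideal.Quotient.mk_surjective

lemma toCohomology_eq_zero_iff {f : SeriesRing p n} :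
    toCohomology hF f = 0 ↔ f ∈ Ideal.span {pSeries hF} :=
  Ideal.Quotient.eq_zero_iff_mem

/-- The map `E_n^*(BC_p) → E_n^*((y))/([p](y))` induced by the inclusion of power series. -/
def cohomologyToLaurent : CohomologyBCp hF →+* LaurentQuotient hF :=
  Ideal.Quotient.lift (Ideal.span {pSeries hF}) (toLaurentQuotient hF) fun f hf => by
    obtain ⟨g, rfl⟩ := Ideal.mem_span_singleton.mp hf
    refine Ideal.Quotient.eq_zero_iff_mem.mpr ?_
    rw [map_mul]
    exact Ideal.mul_mem_right _ _ (Ideal.mem_span_singleton_self _)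

lemma isLocalization_laurentQuotient :
    letI := (cohomologyToLaurent hF).toAlgebra
    IsLocalization.Away (eulerClass hF) (LaurentQuotient hF) := by
  let := (cohomologyToLaurent hF).toAlgebra
  change IsLocalization _ _
  rw [isLocalization_iff]
  refine ⟨?_, fun z => ?_, fun {a b} hab => ?_⟩
  · rintro ⟨_, N, rfl⟩
    change IsUnit (cohomologyToLaurent hF (eulerClass hF ^ N))
    rw [map_pow]
    exact (isUnit_seriesToLaurent_y.map (Ideal.Quotient.mk _)).pow N
  · obtain ⟨l, rfl⟩ := Ideal.Quotient.mk_surjective z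
    obtain ⟨N, f, h⟩ := exists_seriesToLaurent_eq l
    refine ⟨⟨toCohomology hF f, ⟨eulerClass hF ^ N, N, rfl⟩⟩, ?_⟩
    have h' := congrArg (Ideal.Quotient.mk (Ideal.span {seriesToLaurent p n (pSeries hF)})) h
    rw [map_mul, mul_comm] at h'
    have e : eulerClass hF ^ N = toCohomology hF (y p n ^ N) := (map_pow _ _ _).symm
    dsimp only
    rw [e]
    exact h'
  · obtain ⟨f, rfl⟩ := toCohomology_surjective hF a
    obtain ⟨g, rfl⟩ := toCohomology_surjective hF b
    have h : seriesToLaurent p n f - seriesToLaurent p n g ∈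
        Ideal.span {seriesToLaurent p n (pSeries hF)} := Ideal.Quotient.eq.mp hab
    obtain ⟨l, hl⟩ := Ideal.mem_span_singleton.mp h
    obtain ⟨N, t, ht⟩ := exists_seriesToLaurent_eq l
    refine ⟨⟨eulerClass hF ^ N, N, rfl⟩, ?_⟩
    change eulerClass hF ^ N * _ = eulerClass hF ^ N * _
    rw [eulerClass, ← map_pow, ← map_mul, ← map_mul, ← sub_eq_zero, ← map_sub,
      toCohomology_eq_zero_iff, Ideal.mem_span_singleton]
    -- If f - g = [p](y) l and y^N l is the power series t, then y^N (f - g) = [p](y) t already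
    -- holds among power series.
    refine ⟨t, seriesToLaurent_injective ?_⟩
    rw [map_sub, map_mul, map_mul, ← mul_sub, hl, map_mul, ← ht]
    ring

/-- The isomorphism `y^{-1} E_n^*(BC_p) ≅ E_n^*((y))/([p](y))`. -/
lemma exists_equiv_laurentQuotient : ∃ φ : LocalizedCohomology hF ≃+* LaurentQuotient hF,
    ∀ f : SeriesRing p n, φ (toLocalized hF f) = toLaurentQuotient hF f := by
  let := (cohomologyToLaurent hF).toAlgebra
  have := isLocalization_laurentQuotient hF
  refine ⟨(IsLocalization.algEquiv (Submonoid.powers (eulerClass hF)) (LocalizedCohomology hF)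
    (LaurentQuotient hF)).toRingEquiv, fun f => ?_⟩
  exact (IsLocalization.algEquiv (Submonoid.powers (eulerClass hF)) (LocalizedCohomology hF)
    (LaurentQuotient hF)).commutes (toCohomology hF f)

/-! ### Landweber exactness and periodicity -/

lemma isLandweberExact_of_mul_mem {R : Type*} [CommRing R] {w : ℕ → R}
    (h : ∀ k x, w k * x ∈ Ideal.ofList ((List.range k).map w) →
      x ∈ Ideal.ofList ((List.range k).map w)) : IsLandweberExact w := by
  refine fun k => ⟨fun i hi => ?_⟩
  have hik : i < k := by simpa using hi
  rw [← List.map_take, List.take_range, min_eq_left hik.le, List.getElem_map, List.getElem_range,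
    isSMulRegular_quotient_iff_mem_of_smul_mem]
  intro x hx
  rw [smul_eq_mul, Ideal.mul_top] at hx ⊢
  exact h i x hx

lemma isPeriodic_of_mul_sub_one_mem {R : Type*} [CommRing R] {w : ℕ → R} {m : ℕ} {x : R}
    (h : Ideal.ofList ((List.range m).map w) ≠ ⊤)
    (hx : w m * x - 1 ∈ Ideal.ofList ((List.range m).map w)) : IsPeriodic w m := by
  refine ⟨Ideal.Quotient.nontrivial_iff.mpr h,
    IsUnit.of_mul_eq_one (Ideal.Quotient.mk _ x) ?_⟩
  rw [← map_mul, ← map_one (Ideal.Quotient.mk _)]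
  exact Ideal.Quotient.eq.mpr hx

lemma isUnit_toLocalized_y_pow (N : ℕ) : IsUnit (toLocalized hF (y p n ^ N)) := by
  rw [map_pow]
  exact (IsLocalization.Away.algebraMap_isUnit (eulerClass hF)).pow N

lemma exists_mul_eq_toLocalized (x : LocalizedCohomology hF) :
    ∃ (N : ℕ) (f : SeriesRing p n), toLocalized hF (y p n ^ N) * x = toLocalized hF f := by
  obtain ⟨⟨a, ⟨_, N, rfl⟩⟩, h⟩ := IsLocalization.surj (Submonoid.powers (eulerClass hF)) x
  obtain ⟨f, rfl⟩ := toCohomology_surjective hF a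
  refine ⟨N, f, ?_⟩
  rw [mul_comm]
  have e : toLocalized hF (y p n ^ N) = algebraMap _ _ (eulerClass hF ^ N) :=
    congrArg (algebraMap _ _) (map_pow (toCohomology hF) (y p n) N)
  rw [e]
  exact h

/-- Brings ideal membership after localization back to E_n^*[[y]]: passing to the quotient adds
[p](y) to the ideal, and inverting y allows a power of y as denominator. -/
lemma toLocalized_mem_map_iff {I : Ideal (SeriesRing p n)} {f : SeriesRing p n} :
    toLocalized hF f ∈ I.map (toLocalized hF) ↔
      ∃ N : ℕ, y p n ^ N * f ∈ I ⊔ Ideal.span {pSeries hF} := by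
  constructor
  · intro h
    rw [toLocalized, ← Ideal.map_map, IsLocalization.mem_map_algebraMap_iff
      (Submonoid.powers (eulerClass hF))] at h
    obtain ⟨⟨⟨c, hc⟩, ⟨_, M, rfl⟩⟩, h⟩ := h
    obtain ⟨i, hi, rfl⟩ := (Ideal.mem_map_iff_of_surjective _ (toCohomology_surjective hF)).mp hc
    dsimp only [RingHom.comp_apply] at h
    rw [← map_mul] at h
    obtain ⟨⟨_, N, rfl⟩, h⟩ := IsLocalization.exists_of_eq
      (M := Submonoid.powers (eulerClass hF)) h
    dsimp only at h
    rw [eulerClass, ← map_pow, ← map_pow, ← map_mul, ← map_mul, ← map_mul, ← sub_eq_zero,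
      ← map_sub, toCohomology_eq_zero_iff] at h
    refine ⟨N + M, ?_⟩
    have h' := add_mem (Ideal.mem_sup_right (S := I) h)
      (Ideal.mem_sup_left (T := Ideal.span {pSeries hF}) (Ideal.mul_mem_left I (y p n ^ N) hi))
    rw [sub_add_cancel] at h'
    convert h' using 1
    ring
  · rintro ⟨N, h⟩
    rw [mem_sup_span_singleton_iff] at h
    obtain ⟨g, hg⟩ := h
    have h' := Ideal.mem_map_of_mem (toLocalized hF) hg
    have h0 : toLocalized hF (pSeries hF) = 0 := by
      rw [toLocalized, RingHom.comp_apply,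
        (toCohomology_eq_zero_iff hF).mpr (Ideal.mem_span_singleton_self _), map_zero]
    rw [map_sub, map_mul, map_mul, h0, zero_mul, sub_zero] at h'
    exact (Ideal.unit_mul_mem_iff_mem _ (isUnit_toLocalized_y_pow hF N)).mp h'

lemma ofList_vLocalized (k : ℕ) : Ideal.ofList ((List.range k).map (vLocalized hF))
    = (vSeriesIdeal p n k).map (toLocalized hF) := by
  rw [vSeriesIdeal, Ideal.map_span, Ideal.ofList, ← Set.range_comp]
  congr 1
  ext x
  simp only [Set.mem_ofPred_eq, List.mem_map, List.mem_range, Set.mem_range, Function.comp_apply]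
  constructor
  · rintro ⟨i, hi, rfl⟩
    exact ⟨⟨i, hi⟩, rfl⟩
  · rintro ⟨i, rfl⟩
    exact ⟨i, i.2, rfl⟩

/-- A power of the unit y lies in this ideal, by `y_pow_mem`. -/
lemma map_vSeriesIdeal_eq_top (hn : 1 ≤ n) {k : ℕ} (hk : n ≤ k) :
    (vSeriesIdeal p n k).map (toLocalized hF) = ⊤ := by
  rw [Ideal.eq_top_iff_one, ← map_one (toLocalized hF), toLocalized_mem_map_iff]
  refine ⟨p ^ n, ?_⟩
  rw [mul_one]
  exact sup_le_sup_right (vSeriesIdeal_mono hk) _ (y_pow_mem hF hn)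

lemma map_vSeriesIdeal_ne_top (hn : 1 ≤ n) :
    (vSeriesIdeal p n (n - 1)).map (toLocalized hF) ≠ ⊤ := by
  rw [Ne, Ideal.eq_top_iff_one, ← map_one (toLocalized hF), toLocalized_mem_map_iff]
  rintro ⟨N, h⟩
  rw [mul_one] at h
  exact y_pow_notMem hF hn N h

/-- I_n = I_{n-1} + (v_{n-1}) generates the unit ideal after inverting y, so v_{n-1} is invertible
mod I_{n-1}. This serves both periodicity and regularity at k = n - 1. -/
lemma exists_mul_vLocalized_sub_one_mem (hn : 1 ≤ n) :
    ∃ x, vLocalized hF (n - 1) * x - 1 ∈ (vSeriesIdeal p n (n - 1)).map (toLocalized hF) := by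
  have h := ofList_vLocalized hF (n - 1 + 1)
  rw [map_vSeriesIdeal_eq_top hF hn (by omega), List.range_succ, List.map_append,
    Ideal.ofList_append, List.map_singleton, Ideal.ofList_singleton, ofList_vLocalized,
    Ideal.eq_top_iff_one, mem_sup_span_singleton_iff] at h
  obtain ⟨x, hx⟩ := h
  refine ⟨x, ?_⟩
  rw [← neg_sub]
  exact neg_mem hx

/-- Three ranges: for k < n - 1 denominators are cleared and regularity on E_n^*(BC_p) applies; for
k = n - 1 the element is a unit in the quotient; for k ≥ n the quotient is zero. -/
lemma mem_map_of_vLocalized_mul_mem (hn : 1 ≤ n) {k : ℕ} {x : LocalizedCohomology hF}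
    (hx : vLocalized hF k * x ∈ (vSeriesIdeal p n k).map (toLocalized hF)) :
    x ∈ (vSeriesIdeal p n k).map (toLocalized hF) := by
  rcases lt_trichotomy (k + 1) n with hk | hk | hk
  · obtain ⟨N, f, hf⟩ := exists_mul_eq_toLocalized hF x
    rw [← Ideal.unit_mul_mem_iff_mem _ (isUnit_toLocalized_y_pow hF N)] at hx ⊢
    rw [mul_left_comm, hf, vLocalized, ← map_mul, toLocalized_mem_map_iff] at hx
    rw [hf, toLocalized_mem_map_iff]
    obtain ⟨M, hM⟩ := hx
    refine ⟨M, mem_sup_of_v_mul_mem hF hk ?_⟩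
    rwa [mul_left_comm] at hM
  · obtain rfl : k = n - 1 := by omega
    obtain ⟨z, hz⟩ := exists_mul_vLocalized_sub_one_mem hF hn
    have h := sub_mem (Ideal.mul_mem_right z _ hx) (Ideal.mul_mem_right x _ hz)
    convert h using 1
    ring
  · rw [map_vSeriesIdeal_eq_top hF hn (by omega)]
    trivial

lemma isLandweberExact_vLocalized (hn : 1 ≤ n) : IsLandweberExact (vLocalized hF) :=
  isLandweberExact_of_mul_mem fun k x hx => by
    rw [ofList_vLocalized] at hx ⊢
    exact mem_map_of_vLocalized_mul_mem hF hn hx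

lemma isPeriodic_vLocalized (hn : 1 ≤ n) : IsPeriodic (vLocalized hF) (n - 1) := by
  obtain ⟨x, hx⟩ := exists_mul_vLocalized_sub_one_mem hF hn
  refine isPeriodic_of_mul_sub_one_mem (x := x) ?_ ?_ <;> rw [ofList_vLocalized]
  · exact map_vSeriesIdeal_ne_top hF hn
  · exact hx

end Localization

end MoravaE

end

theorem proposition3p2 (p n : ℕ) [Fact p.Prime] (hn : 1 ≤ n)
    (F : FormalGroup (MoravaE.Coeff p n)) (hF : MoravaE.IsMoravaFormalGroup p n F) :
    (∃ φ : MoravaE.LocalizedCohomology hF ≃+* MoravaE.LaurentQuotient hF,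
      ∀ f : MoravaE.SeriesRing p n,
        φ (MoravaE.toLocalized hF f) = MoravaE.toLaurentQuotient hF f) ∧
    MoravaE.IsLandweberExact (MoravaE.vLocalized hF) ∧
    MoravaE.IsPeriodic (MoravaE.vLocalized hF) (n - 1) :=
  ⟨MoravaE.exists_equiv_laurentQuotient hF, MoravaE.isLandweberExact_vLocalized hF hn,
    MoravaE.isPeriodic_vLocalized hF hn⟩
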